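/- Let $n\ge 1$, $b>0$, $\overline v>0$, and let $f$ be a probability density on $[0,b]$ (measurable, $f\ge 0$, $\int_0^b f=1$; differentiability is not needed). One item is sold to $n$ bidders whose types are drawn independently from $f$. A feasible mechanism is given by measurable allocation probabilities $q_i(t_1,\dots,t_n)\ge 0$, $i=1,\dots,n$, with $\sum_i q_i(\mathbf t)\le 1$ for all $\mathbf t\in[0,b]^n$. It implements the interim allocation rule $q$, a measurable function $q:[0,b]\to[0,\infty)$, if for every bidder $i$ one has $\mathbb E_{\mathbf t_{-i}}[q_i(t,\mathbf t_{-i})]=q(t)$ for $f$-almost every $t\in[0,b]$. Then there exists a feasible mechanism that implements $q$ if and only if for every measurable $x:[0,b]\to[0,\overline v]$ the function $qfx$ is integrable and $$\int_0^b q(t)f(t)x(t)\,dt\;\le\;\int_0^{\overline v}\frac{1-\bigl(1-\int_{\{t:\,x(t)\ge v\}}f(t)\,dt\bigr)^n}{n}\,dv .$$ Moreover, let $q$ be implementable and let $x:[0,b]\to[0,\overline v]$ be a measurable function for which equality holds in this inequality. Then for all measurable $C,D\subseteq[0,b]$ with $\int_C f>0$, $\int_D f>0$ and $x(c)>x(d)$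 for all $c\in C$, $d\in D$ (that is, $\min_C x>\max_D x$ when these are attained), $$\frac{\int_C q(t)f(t)\,dt}{\int_C f(t)\,dt}\;\ge\;\frac{\int_D q(t)f(t)\,dt}{\int_D f(t)\,dt}.$$ -/

import Mathlib

open MeasureTheory

noncomputable section

/-- The law of one bidder's type: the measure on `[0, b]` with density `f`. -/
def typeLaw (b : ℝ) (f : ℝ → ℝ) : Measure ℝ :=
  (volume.restrict (Set.Icc 0 b)).withDensity (fun t => ENNReal.ofReal (f t))

/-- A feasible (ex post) allocation rule of a direct mechanism that sells one item to `n` bidders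
with types in `[0, b]`: `alloc i t` is the probability that bidder `i` receives the item when the
reported type profile is `t`. -/
structure FeasibleAllocation (n : ℕ) (b : ℝ) where
  alloc : Fin n → (Fin n → ℝ) → ℝ
  measurable_alloc : ∀ i, Measurable (alloc i)
  alloc_nonneg : ∀ t : Fin n → ℝ, (∀ k, t k ∈ Set.Icc 0 b) → ∀ i, 0 ≤ alloc i t
  sum_alloc_le_one : ∀ t : Fin n → ℝ, (∀ k, t k ∈ Set.Icc 0 b) → ∑ i, alloc i t ≤ 1

/-- The interim allocation of bidder `i` at type `t`: the expectation of `alloc i (t, s₋ᵢ)` when the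
types of the other bidders are i.i.d. with density `f`. All `n` coordinates of `s` are drawn, and
the `i`-th one is then overwritten by `t`. -/
def FeasibleAllocation.interim {n : ℕ} {b : ℝ} (M : FeasibleAllocation n b) (f : ℝ → ℝ)
    (i : Fin n) (t : ℝ) : ℝ :=
  ∫ s, M.alloc i (Function.update s i t) ∂(Measure.pi (fun _ : Fin n => typeLaw b f))

/-- `q` is implementable: some feasible allocation rule gives every bidder the interim allocation
`q`, at almost every type with respect to the type distribution. -/
def Implementable (n : ℕ) (b : ℝ) (f q : ℝ → ℝ) : Prop :=
  ∃ M : FeasibleAllocation n b, ∀ i : Fin n, ∀ᵐ t ∂(typeLaw b f), M.interim f i t = q t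

/-- A (measurable) virtual value function on `[0, b]` with values in `[0, vbar]`. -/
def IsVirtualValue (b vbar : ℝ) (x : ℝ → ℝ) : Prop :=
  Measurable x ∧ ∀ t ∈ Set.Icc 0 b, x t ∈ Set.Icc 0 vbar

/-- The bound `∫₀^vbar (1 - (1 - ∫_{x(t) ≥ v} f(t) dt)ⁿ) / n dv`. -/
def borderBound (n : ℕ) (b vbar : ℝ) (f x : ℝ → ℝ) : ℝ :=
  ∫ v in (0 : ℝ)..vbar, (1 - (1 - ∫ t in {t ∈ Set.Icc 0 b | v ≤ x t}, f t) ^ n) / n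

end

/-! Let μ be the law of a type. The bound in Border's condition is E[max x(t_i)] / n, since the
maximum is below v exactly when all n independent values are. Necessity: a feasible mechanism has ∑
q_i(t) x(t_i) ≤ max x(t_i) almost surely, and by Fubini the left side has expectation n ∫ q x dμ.
Equality of the expectations forces equality almost surely, so the item goes only to maximizers of
x, and fully if the maximum is positive. Raising one bidder's x then cannot lower that bidder's
allocation (`alloc_le_of_sum_mul_eq_ciSup`), and averaging gives the monotonicity statement.
Sufficiency: feasible rules form a bounded closed convex set in a Hilbert space, so its image under
the continuous linear interim map is closed (`exists_map_eq_of_forall_functional_le`). By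
Hahn-Banach it is enough that no functional separates (q, ..., q) from this image. A functional is a
tuple of weights x_i, possibly different across bidders, and its best response gives the item to the
largest positive x_i(t_i). Border's condition treats one weight at a time; the AM-GM inequality,
applied to the distribution functions of the x_i, combines the n bounds into the required one
(`BorderCondition.sum_le_integral_iSup`). -/

open Filter Topology

/-! ### Convex sets in Hilbert spaces -/

section Hilbert

variable {H : Type*} [NormedAddCommGroup H] [InnerProductSpace ℝ H] [CompleteSpace H]

/-- Nested nonempty bounded closed convex subsets of a Hilbert space have a common point. -/
theorem nonempty_iInter_of_antitone_convex {C : ℕ → Set H} (hanti : Antitone C)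
    (hne : ∀ k, (C k).Nonempty) (hconv : ∀ k, Convex ℝ (C k)) (hclosed : ∀ k, IsClosed (C k))
    {R : ℝ} (hR : ∀ a ∈ C 0, ‖a‖ ≤ R) : (⋂ k, C k).Nonempty := by
  have hmin : ∀ k, ∃ p ∈ C k, ∀ a ∈ C k, ‖p‖ ≤ ‖a‖ := by
    intro k
    obtain ⟨p, hp, hp'⟩ := exists_norm_eq_iInf_of_complete_convex (hne k)
      (hclosed k).isComplete (hconv k) 0
    refine ⟨p, hp, fun a ha => ?_⟩
    have hle : ⨅ w : C k, ‖(0 : H) - w‖ ≤ ‖(0 : H) - a‖ :=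
      ciInf_le (f := fun w : C k => ‖(0 : H) - w‖)
        ⟨0, by rintro _ ⟨w, rfl⟩; exact norm_nonneg _⟩ ⟨a, ha⟩
    rw [← hp'] at hle
    simpa using hle
  choose p hpC hpmin using hmin
  have hmono : Monotone fun k => ‖p k‖ ^ 2 := fun k l hkl =>
    pow_le_pow_left₀ (norm_nonneg _) (hpmin k _ (hanti hkl (hpC l))) 2
  have hbdd : BddAbove (Set.range fun k => ‖p k‖ ^ 2) := by
    refine ⟨R ^ 2, ?_⟩
    rintro _ ⟨k, rfl⟩
    exact pow_le_pow_left₀ (norm_nonneg _) (hR _ (hanti (Nat.zero_le k) (hpC k))) 2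
  set d := ⨆ k, ‖p k‖ ^ 2
  have hlim : Tendsto (fun k => ‖p k‖ ^ 2) atTop (𝓝 d) := tendsto_atTop_ciSup hmono hbdd
  -- The midpoint of `p k` and `p l` lies in `C k`, so its norm is at least `‖p k‖`; the
  -- parallelogram law then makes the minimal-norm points a Cauchy sequence.
  have hdist : ∀ k l, k ≤ l → dist (p k) (p l) ≤ √(2 * (d - ‖p k‖ ^ 2)) := by
    intro k l hkl
    rw [dist_eq_norm]
    refine Real.le_sqrt_of_sq_le ?_
    have hmid : midpoint ℝ (p k) (p l) ∈ C k :=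
      (hconv k).midpoint_mem (hpC k) (hanti hkl (hpC l))
    have h1 : ‖p k‖ ≤ 2⁻¹ * ‖p k + p l‖ := by
      have h := hpmin k _ hmid
      rwa [midpoint_eq_smul_add, norm_smul, invOf_eq_inv, norm_inv, Real.norm_two] at h
    have h2 := parallelogram_law_with_norm ℝ (p k) (p l)
    have h3 : ‖p l‖ ^ 2 ≤ d := le_ciSup hbdd l
    nlinarith [norm_nonneg (p k), norm_nonneg (p k + p l)]
  have hzero : Tendsto (fun k => √(2 * (d - ‖p k‖ ^ 2))) atTop (𝓝 0) := by
    have h : Tendsto (fun k => √(2 * (d - ‖p k‖ ^ 2))) atTop (𝓝 √(2 * (d - d))) :=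
      (Real.continuous_sqrt.tendsto _).comp ((tendsto_const_nhds.sub hlim).const_mul 2)
    simpa using h
  obtain ⟨a, ha⟩ := cauchySeq_tendsto_of_complete <| cauchySeq_of_le_tendsto_0'
    (fun k => √(2 * (d - ‖p k‖ ^ 2))) hdist hzero
  refine ⟨a, Set.mem_iInter.2 fun k => (hclosed k).mem_of_tendsto ha ?_⟩
  filter_upwards [eventually_ge_atTop k] with l hl using hanti hl (hpC l)

/-- A point that no continuous functional separates from the image of a bounded closed convex set
under a continuous linear map lies in that image. -/
theorem exists_map_eq_of_forall_functional_le {K : Type*} [NormedAddCommGroup K]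
    [NormedSpace ℝ K] (T : H →L[ℝ] K) {A : Set H} (hconv : Convex ℝ A)
    (hclosed : IsClosed A) {R : ℝ} (hR : ∀ a ∈ A, ‖a‖ ≤ R) (z : K)
    (hz : ∀ φ : K →L[ℝ] ℝ, ∃ a ∈ A, φ z ≤ φ (T a)) : ∃ a ∈ A, T a = z := by
  have hcl : z ∈ closure (T '' A) := by
    by_contra hnot
    obtain ⟨φ, u, h1, h2⟩ := geometric_hahn_banach_closed_point
      (hconv.is_linear_image T.toLinearMap.isLinear).closure isClosed_closure hnot
    obtain ⟨a, ha, hle⟩ := hz φ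
    exact absurd (h1 _ (subset_closure ⟨a, ha, rfl⟩)) (not_lt.2 (h2.le.trans hle))
  -- Approximate solutions with error at most 1/(k+1) form nested convex sets; a common point is an
  -- exact solution. This replaces weak compactness.
  obtain ⟨a, ha⟩ := nonempty_iInter_of_antitone_convex
    (C := fun k : ℕ => A ∩ T ⁻¹' Metric.closedBall z (1 / ((k : ℝ) + 1)))
    (fun k l hkl => Set.inter_subset_inter_right _ <| Set.preimage_mono <|
      Metric.closedBall_subset_closedBall <| one_div_le_one_div_of_le (by positivity) (by gcongr))
    (fun k => by
      obtain ⟨_, ⟨a, ha, rfl⟩, h⟩ := Metric.mem_closure_iff.1 hcl (1 / ((k : ℝ) + 1))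
        (by positivity)
      exact ⟨a, ha, by rw [Set.mem_preimage, Metric.mem_closedBall, dist_comm]; exact h.le⟩)
    (fun k => hconv.inter ((convex_closedBall _ _).is_linear_preimage T.toLinearMap.isLinear))
    (fun k => hclosed.inter (Metric.isClosed_closedBall.preimage T.continuous))
    (R := R) (fun a ha => hR a ha.1)
  rw [Set.mem_iInter] at ha
  refine ⟨a, (ha 0).1, dist_le_zero.1 ?_⟩
  exact ge_of_tendsto' tendsto_one_div_add_atTop_nhds_zero_nat fun k => (ha k).2

end Hilbert

/-! ### Product measures -/

section Product

variable {ι : Type*} [Fintype ι] {X : Type*} [MeasurableSpace X]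
  (μ : Measure X) [IsProbabilityMeasure μ]

theorem ae_pi_eval {p : X → Prop} (hp : ∀ᵐ t ∂μ, p t) (i : ι) :
    ∀ᵐ s ∂(Measure.pi fun _ : ι => μ), p (s i) :=
  (measurePreserving_eval (fun _ : ι => μ) i).quasiMeasurePreserving.ae hp

variable [DecidableEq ι]

/-- Redrawing one independent coordinate does not change the joint law: the preimage of a box is a
box whose i-th side is the whole space, of mass one. This fits interim allocations, where a full
profile is drawn and one entry overwritten. -/
theorem measurePreserving_update (i : ι) :
    MeasurePreserving (fun p : X × (ι → X) => Function.update p.2 i p.1)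
      (μ.prod (Measure.pi fun _ => μ)) (Measure.pi fun _ : ι => μ) := by
  have hmeas : Measurable fun p : X × (ι → X) => Function.update p.2 i p.1 := by
    refine measurable_pi_lambda _ fun j => ?_
    by_cases hj : j = i
    · subst hj; simpa using measurable_fst
    · simpa [hj, Function.comp_def] using (measurable_pi_apply j).comp measurable_snd
  refine ⟨hmeas, (Measure.pi_eq fun s hs => ?_).symm⟩
  rw [Measure.map_apply hmeas (MeasurableSet.univ_pi hs)]
  have hpre : (fun p : X × (ι → X) => Function.update p.2 i p.1) ⁻¹' Set.univ.pi s
      = s i ×ˢ Set.univ.pi (Function.update s i Set.univ) := by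
    ext ⟨t, w⟩
    simp only [Set.mem_preimage, Set.mem_univ_pi, Set.mem_prod]
    constructor
    · intro h
      refine ⟨by simpa using h i, fun j => ?_⟩
      by_cases hj : j = i
      · subst hj; simp
      · simpa [hj] using h j
    · rintro ⟨h1, h2⟩ j
      by_cases hj : j = i
      · subst hj; simpa using h1
      · simpa [hj] using h2 j
  rw [hpre, Measure.prod_prod, Measure.pi_pi,
    ← Finset.mul_prod_erase Finset.univ (fun j => μ (s j)) (Finset.mem_univ i),
    ← Finset.mul_prod_erase Finset.univ _ (Finset.mem_univ i)]
  simp only [Function.update_self, measure_univ, one_mul]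
  congr 1
  exact Finset.prod_congr rfl fun j hj => by
    rw [Function.update_of_ne (Finset.ne_of_mem_erase hj)]

theorem ae_ae_update {p : (ι → X) → Prop} (hp : ∀ᵐ s ∂(Measure.pi fun _ : ι => μ), p s) (i : ι) :
    ∀ᵐ t ∂μ, ∀ᵐ s ∂(Measure.pi fun _ : ι => μ), p (Function.update s i t) :=
  Measure.ae_ae_of_ae_prod ((measurePreserving_update μ i).quasiMeasurePreserving.ae hp)

/-- Fubini's theorem for one coordinate of a product measure. -/
theorem integral_pi_mul_eval (i : ι) {a : (ι → X) → ℝ} {y : X → ℝ}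
    (h : Integrable (fun s => a s * y (s i)) (Measure.pi fun _ : ι => μ)) :
    ∫ s, a s * y (s i) ∂(Measure.pi fun _ : ι => μ) =
      ∫ t, (∫ s, a (Function.update s i t) ∂(Measure.pi fun _ : ι => μ)) * y t ∂μ := by
  have hmp := measurePreserving_update μ i
  have h1 : Integrable (fun p : X × (ι → X) => a (Function.update p.2 i p.1) * y p.1)
      (μ.prod (Measure.pi fun _ => μ)) := by
    have := (hmp.integrable_comp h.aestronglyMeasurable).2 h
    simpa [Function.comp_def] using this
  have h2 := integral_map hmp.aemeasurable (f := fun s => a s * y (s i))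
    (by rw [hmp.map_eq]; exact h.aestronglyMeasurable)
  rw [hmp.map_eq] at h2
  simp only [Function.update_self] at h2
  rw [h2, integral_prod _ h1]
  simp only [integral_mul_const]

end Product

/-- AM-GM for the numbers `z i ^ n`. -/
theorem Finset.prod_le_sum_pow_div {n : ℕ} (hn : 1 ≤ n) (z : Fin n → ℝ) (hz : ∀ i, 0 ≤ z i) :
    ∏ i, z i ≤ (∑ i, z i ^ n) / n := by
  have hn' : (n : ℝ) ≠ 0 := by positivity
  have h := Real.geom_mean_le_arith_mean_weighted Finset.univ (fun _ : Fin n => (n : ℝ)⁻¹)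
    (fun i => z i ^ n) (fun _ _ => by positivity) (by simp [hn']) (fun i _ => pow_nonneg (hz i) n)
  rw [← Finset.mul_sum, inv_mul_eq_div] at h
  refine le_of_eq_of_le (Finset.prod_congr rfl fun i _ => ?_) h
  exact (Real.pow_rpow_inv_natCast (hz i) (by lia)).symm

/-! ### Expected maximum of independent variables -/

section Maximum

variable {ι : Type*} [Fintype ι] [Nonempty ι] {X : Type*} [MeasurableSpace X]
  {μ : Measure X} [IsProbabilityMeasure μ]

theorem ciSup_mem_Icc_of_finite {g : ι → ℝ} {M : ℝ} (h : ∀ i, g i ∈ Set.Icc 0 M) :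
    ⨆ i, g i ∈ Set.Icc 0 M := by
  obtain ⟨i, hi⟩ := exists_eq_ciSup_of_finite (f := g)
  exact hi ▸ h i

theorem integrable_iSup_eval {y : ι → X → ℝ} (hy : ∀ i, Measurable (y i)) {M : ℝ}
    (hM : ∀ i, ∀ᵐ t ∂μ, y i t ∈ Set.Icc 0 M) :
    Integrable (fun s : ι → X => ⨆ i, y i (s i)) (Measure.pi fun _ : ι => μ) := by
  refine Integrable.of_bound (C := M) (Measurable.iSup fun i =>
    (hy i).comp (measurable_pi_apply i)).aestronglyMeasurable ?_
  filter_upwards [ae_all_iff.2 fun i => ae_pi_eval μ (hM i) i] with s hs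
  have h := ciSup_mem_Icc_of_finite hs
  rw [Real.norm_of_nonneg h.1]
  exact h.2

/-- The expected maximum of independent random variables with values in `[0, M]`. -/
theorem integral_iSup_eval {y : ι → X → ℝ} (hy : ∀ i, Measurable (y i)) {M : ℝ} (hM0 : 0 ≤ M)
    (hM : ∀ i, ∀ᵐ t ∂μ, y i t ∈ Set.Icc 0 M) :
    ∫ s : ι → X, ⨆ i, y i (s i) ∂(Measure.pi fun _ : ι => μ) =
      ∫ v in (0 : ℝ)..M, (1 - ∏ i, (1 - μ.real {t | v ≤ y i t})) := by
  have hae := ae_all_iff.2 fun i => ae_pi_eval μ (hM i) i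
  rw [Integrable.integral_eq_integral_Ioc_meas_le (integrable_iSup_eval hy hM)
    (by filter_upwards [hae] with s hs using (ciSup_mem_Icc_of_finite hs).1)
    (by filter_upwards [hae] with s hs using (ciSup_mem_Icc_of_finite hs).2),
    intervalIntegral.integral_of_le hM0]
  refine integral_congr_ae (.of_forall fun v => ?_)
  have hset : {s : ι → X | v ≤ ⨆ i, y i (s i)} = (Set.univ.pi fun i => {t | v ≤ y i t}ᶜ)ᶜ := by
    ext s
    simp only [Set.mem_ofPred_eq, Set.mem_compl_iff, Set.mem_univ_pi, not_forall, not_not]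
    constructor
    · intro h
      obtain ⟨i, hi⟩ := exists_eq_ciSup_of_finite (f := fun i => y i (s i))
      exact ⟨i, hi ▸ h⟩
    · rintro ⟨i, hi⟩
      exact hi.trans (le_ciSup (Set.finite_range fun i => y i (s i)).bddAbove i)
  have hms : ∀ i, MeasurableSet {t | v ≤ y i t} := fun i => measurableSet_le measurable_const (hy i)
  simp only
  rw [hset, probReal_compl_eq_one_sub (MeasurableSet.univ_pi fun i => (hms i).compl)]
  congr 1
  rw [measureReal_def, Measure.pi_pi, ENNReal.toReal_prod]
  exact Finset.prod_congr rfl fun i _ => probReal_compl_eq_one_sub (hms i)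

end Maximum

theorem intervalIntegrable_comp_measureReal {X : Type*} [MeasurableSpace X]
    {μ : Measure X} [IsProbabilityMeasure μ] (y : X → ℝ) {n : ℕ} (a b : ℝ) :
    IntervalIntegrable (fun v => (1 - (1 - μ.real {t | v ≤ y t}) ^ n) / n) volume a b := by
  refine Antitone.intervalIntegrable fun v w hvw => ?_
  have h2 : μ.real {t | v ≤ y t} ≤ 1 := measureReal_le_one
  gcongr
  exact measure_ne_top _ _

/-! ### From Border's condition to bounds for tuples of weights -/

section Sufficiency

variable {X : Type*} [MeasurableSpace X]

/-- Border's condition with respect to a general type distribution. -/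
def BorderCondition (n : ℕ) (M : ℝ) (μ : Measure X) (q : X → ℝ) : Prop :=
  ∀ y : X → ℝ, Measurable y → (∀ t, y t ∈ Set.Icc 0 M) →
    Integrable (fun t => q t * y t) μ ∧
      ∫ t, q t * y t ∂μ ≤ ∫ v in (0 : ℝ)..M, (1 - (1 - μ.real {t | v ≤ y t}) ^ n) / n

variable {μ : Measure X} {n : ℕ} {M : ℝ} {q : X → ℝ}

theorem BorderCondition.integrable (h : BorderCondition n M μ q) (hM : 0 < M) :
    Integrable q μ := by
  have h1 := (h (fun _ => M) measurable_const fun _ => ⟨hM.le, le_rfl⟩).1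
  simpa [hM.ne'] using h1.mul_const M⁻¹

variable [IsProbabilityMeasure μ]

/-- Testing with M times the indicator of E = {q > 1} gives ∫_E q ≤ (1 - (1 - μ E)^n) / n, which is
at most μ E by Bernoulli's inequality; hence E is null. -/
theorem BorderCondition.ae_le_one (h : BorderCondition n M μ q) (hn : 1 ≤ n) (hM : 0 < M)
    (hq : Measurable q) : ∀ᵐ t ∂μ, q t ≤ 1 := by
  have hn' : (0 : ℝ) < n := by exact_mod_cast hn
  set E := {t | 1 < q t}
  have hE : MeasurableSet E := measurableSet_lt measurable_const hq
  have hset : ∀ v ∈ Set.Ioc 0 M, {t | v ≤ E.indicator (fun _ => M) t} = E := by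
    intro v hv
    ext t
    by_cases ht : t ∈ E
    · simp [ht, hv.2]
    · simp [ht, hv.1]
  obtain ⟨-, h2⟩ := h (E.indicator fun _ => M) (measurable_const.indicator hE) fun t => by
    by_cases ht : t ∈ E <;> simp [ht, hM.le]
  have h3 : ∫ v in (0 : ℝ)..M, (1 - (1 - μ.real {t | v ≤ E.indicator (fun _ => M) t}) ^ n) / n
      = M * ((1 - (1 - μ.real E) ^ n) / n) := by
    rw [intervalIntegral.integral_of_le hM.le, setIntegral_congr_fun measurableSet_Ioc
      (g := fun _ => (1 - (1 - μ.real E) ^ n) / n) fun v hv => by simp only [hset v hv]]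
    simp [hM.le]
  have h4 : ∫ t, q t * E.indicator (fun _ => M) t ∂μ = (∫ t in E, q t ∂μ) * M := by
    rw [← integral_mul_const, ← integral_indicator hE]
    congr 1 with t
    by_cases ht : t ∈ E <;> simp [ht]
  have h5 : (1 - (1 - μ.real E) ^ n) / n ≤ μ.real E := by
    rw [div_le_iff₀ hn']
    have hle : μ.real E ≤ 1 := measureReal_le_one
    have := one_add_mul_le_pow (a := -μ.real E) (by linarith) n
    rw [← sub_eq_add_neg] at this
    linarith
  have h6 : ∫ t in E, q t ∂μ ≤ μ.real E := by
    rw [h3, h4, mul_comm M] at h2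
    exact (le_of_mul_le_mul_right h2 hM).trans h5
  have hint := (h.integrable hM).integrableOn (s := E)
  have h7 : ∫ t in E, (q t - 1) ∂μ ≤ 0 := by
    rw [integral_sub hint (integrable_const _)]
    simpa using h6
  have hpos : 0 ≤ᵐ[μ.restrict E] fun t => q t - 1 := by
    filter_upwards [ae_restrict_mem hE] with t ht
    exact sub_nonneg.2 (le_of_lt ht)
  have h8 := (integral_eq_zero_iff_of_nonneg_ae hpos (hint.sub (integrable_const _))).1
    (le_antisymm h7 (integral_nonneg_of_ae hpos))
  rw [EventuallyEq, ae_restrict_iff' hE] at h8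
  filter_upwards [h8] with t ht
  by_contra! hlt
  have := ht hlt
  simp only [Pi.zero_apply] at this
  linarith

/-- With z_i = 1 - μ{y_i ≥ v}, AM-GM gives ∑ (1 - z_i^n) / n ≤ 1 - ∏ z_i. Integrating over v
compares the n separate bounds with the expected maximum of differing weights. -/
theorem BorderCondition.sum_le_integral_iSup (h : BorderCondition n M μ q) (hn : 1 ≤ n)
    (hM : 0 < M) {y : Fin n → X → ℝ} (hy : ∀ i, Measurable (y i))
    (hyM : ∀ i t, y i t ∈ Set.Icc 0 M) :
    ∑ i, ∫ t, q t * y i t ∂μ ≤ ∫ s : Fin n → X, ⨆ i, y i (s i) ∂(Measure.pi fun _ => μ) := by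
  have : Nonempty (Fin n) := ⟨⟨0, hn⟩⟩
  have hn' : (n : ℝ) ≠ 0 := by positivity
  rw [integral_iSup_eval hy hM.le fun i => .of_forall (hyM i)]
  refine (Finset.sum_le_sum fun i _ => (h (y i) (hy i) (hyM i)).2).trans ?_
  rw [← intervalIntegral.integral_finsetSum fun i _ =>
    intervalIntegrable_comp_measureReal (y i) 0 M]
  refine intervalIntegral.integral_mono_on hM.le
    (by simpa only [Finset.sum_fn] using IntervalIntegrable.sum Finset.univ fun i _ =>
      intervalIntegrable_comp_measureReal (μ := μ) (n := n) (y i) 0 M) ?_ ?_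
  · refine Antitone.intervalIntegrable fun v w hvw => ?_
    have h2 : ∀ v i, μ.real {t | v ≤ y i t} ≤ 1 := fun v i => measureReal_le_one
    gcongr
    · exact fun i _ => sub_nonneg.2 (h2 v i)
    · exact measure_ne_top _ _
  · intro v _
    have h2 : ∀ i, μ.real {t | v ≤ y i t} ≤ 1 := fun i => measureReal_le_one
    have h3 := Finset.prod_le_sum_pow_div hn (fun i => 1 - μ.real {t | v ≤ y i t})
      fun i => by linarith [h2 i]
    rw [← Finset.sum_div, Finset.sum_sub_distrib, sub_div]
    simp only [Finset.sum_const, Finset.card_univ, Fintype.card_fin, nsmul_eq_mul, mul_one]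
    rw [div_self hn']
    linarith

/-- Border's condition bounds the interim values of all bounded weights. -/
theorem BorderCondition.sum_le_of_bounded (h : BorderCondition n M μ q) (hn : 1 ≤ n)
    (hM : 0 < M) {c : ℝ} (hc : 0 < c) {y : Fin n → X → ℝ} (hy : ∀ i, Measurable (y i))
    (hyc : ∀ i t, y i t ∈ Set.Icc 0 c) {G : (Fin n → X) → ℝ}
    (hG : Integrable G (Measure.pi fun _ => μ)) (hyG : ∀ s i, y i (s i) ≤ G s) :
    ∑ i, ∫ t, q t * y i t ∂μ ≤ ∫ s, G s ∂(Measure.pi fun _ => μ) := by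
  have : Nonempty (Fin n) := ⟨⟨0, hn⟩⟩
  have hk : 0 < M / c := div_pos hM hc
  have hmem : ∀ i t, M / c * y i t ∈ Set.Icc 0 M := fun i t =>
    ⟨mul_nonneg hk.le (hyc i t).1, by
      calc M / c * y i t ≤ M / c * c := by gcongr; exact (hyc i t).2
        _ = M := div_mul_cancel₀ _ hc.ne'⟩
  have hmeas : ∀ i, Measurable fun t => M / c * y i t := fun i => (hy i).const_mul _
  have h1 := h.sum_le_integral_iSup hn hM hmeas hmem
  have h2 : ∫ s : Fin n → X, ⨆ i, M / c * y i (s i) ∂(Measure.pi fun _ => μ)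
      ≤ ∫ s, M / c * G s ∂(Measure.pi fun _ => μ) :=
    integral_mono (integrable_iSup_eval hmeas fun i => .of_forall (hmem i)) (hG.const_mul _)
      fun s => ciSup_le fun i => mul_le_mul_of_nonneg_left (hyG s i) hk.le
  have h3 := h1.trans h2
  simp only [mul_left_comm _ (M / c), integral_const_mul, ← Finset.mul_sum] at h3
  exact le_of_mul_le_mul_left h3 hk

/-- Border's condition bounds the interim values of all integrable weights. -/
theorem BorderCondition.sum_le_of_integrable (h : BorderCondition n M μ q) (hn : 1 ≤ n)
    (hM : 0 < M) (hq : Measurable q) (hq0 : ∀ᵐ t ∂μ, 0 ≤ q t) {x : Fin n → X → ℝ}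
    (hx : ∀ i, Measurable (x i)) (hxi : ∀ i, Integrable (x i) μ) {G : (Fin n → X) → ℝ}
    (hG : Integrable G (Measure.pi fun _ => μ)) (hG0 : ∀ s, 0 ≤ G s)
    (hxG : ∀ s i, x i (s i) ≤ G s) :
    ∑ i, ∫ t, q t * x i t ∂μ ≤ ∫ s, G s ∂(Measure.pi fun _ => μ) := by
  have hq1 := h.ae_le_one hn hM hq
  have hqi : ∀ {g : X → ℝ}, Integrable g μ → Integrable (fun t => q t * g t) μ := by
    intro g hg
    refine hg.bdd_mul (c := 1) hq.aestronglyMeasurable ?_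
    filter_upwards [hq0, hq1] with t h0 h1
    rwa [Real.norm_of_nonneg h0]
  have hmono : ∑ i, ∫ t, q t * x i t ∂μ ≤ ∑ i, ∫ t, q t * max (x i t) 0 ∂μ := by
    refine Finset.sum_le_sum fun i _ => integral_mono_ae (hqi (hxi i)) (hqi (hxi i).pos_part) ?_
    filter_upwards [hq0] with t h0
    exact mul_le_mul_of_nonneg_left (le_max_left _ _) h0
  refine hmono.trans ?_
  -- Positive parts are truncated at k + 1, which is positive even for k = 0, as rescaling to [0, M]
  -- requires. Since 0 ≤ q ≤ 1 almost everywhere, `|x i|` dominates in the limit.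
  have htr : ∀ k : ℕ, ∑ i, ∫ t, q t * min (max (x i t) 0) ((k : ℝ) + 1) ∂μ
      ≤ ∫ s, G s ∂(Measure.pi fun _ => μ) := fun k =>
    h.sum_le_of_bounded hn hM (c := (k : ℝ) + 1) (by positivity)
      (y := fun i t => min (max (x i t) 0) ((k : ℝ) + 1))
      (fun i => ((hx i).max measurable_const).min measurable_const)
      (fun i t => ⟨le_min (le_max_right _ _) (by positivity), min_le_right _ _⟩) hG
      fun s i => (min_le_left _ _).trans (max_le (hxG s i) (hG0 s))
  refine le_of_tendsto' (x := atTop) (tendsto_finsetSum _ fun i _ => ?_) htr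
  refine tendsto_integral_of_dominated_convergence (fun t => |x i t|)
    (fun k => (hq.mul (((hx i).max measurable_const).min measurable_const)).aestronglyMeasurable)
    (hxi i).abs (fun k => ?_) (.of_forall fun t => ?_)
  · filter_upwards [hq0, hq1] with t h0 h1
    have h2 : 0 ≤ min (max (x i t) 0) ((k : ℝ) + 1) := le_min (le_max_right _ _) (by positivity)
    rw [Real.norm_of_nonneg (mul_nonneg h0 h2)]
    calc q t * min (max (x i t) 0) ((k : ℝ) + 1) ≤ 1 * max (x i t) 0 :=
          mul_le_mul h1 (min_le_left _ _) h2 zero_le_one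
      _ ≤ |x i t| := by rw [one_mul]; exact max_le (le_abs_self _) (abs_nonneg _)
  · refine tendsto_const_nhds.congr' ?_
    filter_upwards [eventually_ge_atTop ⌈max (x i t) 0⌉₊] with k hk
    rw [min_eq_left ((Nat.ceil_le.1 hk).trans (by linarith))]

end Sufficiency

/-! ### Allocation to the first maximal positive entry -/

open Classical in
/-- The indicator that `i` is the first index at which `u` attains its maximum, and that this
maximum is positive. -/
noncomputable def firstArgmax {n : ℕ} (i : Fin n) (u : Fin n → ℝ) : ℝ :=
  if 0 < u i ∧ (∀ j, u j ≤ u i) ∧ ∀ j < i, u j < u i then 1 else 0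

theorem measurable_firstArgmax {n : ℕ} (i : Fin n) : Measurable (firstArgmax i) := by
  refine Measurable.ite ?_ measurable_const measurable_const
  measurability

theorem firstArgmax_nonneg {n : ℕ} (i : Fin n) (u : Fin n → ℝ) : 0 ≤ firstArgmax i u := by
  unfold firstArgmax; split_ifs <;> norm_num

theorem sum_firstArgmax_of_cond {n : ℕ} {i : Fin n} {u : Fin n → ℝ}
    (h : 0 < u i ∧ (∀ j, u j ≤ u i) ∧ ∀ j < i, u j < u i) (g : Fin n → ℝ) :
    ∑ j, firstArgmax j u * g j = g i := by
  rw [Finset.sum_eq_single i]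
  · rw [firstArgmax, if_pos h, one_mul]
  · intro j _ hj
    rw [firstArgmax, if_neg, zero_mul]
    rintro ⟨-, h2, h3⟩
    rcases lt_or_gt_of_ne hj with hlt | hlt
    · exact absurd (h.2.2 j hlt) (not_lt.2 (h2 i))
    · exact absurd (h3 i hlt) (not_lt.2 (h.2.1 j))
  · simp

theorem sum_firstArgmax_le_one {n : ℕ} (u : Fin n → ℝ) : ∑ i, firstArgmax i u ≤ 1 := by
  by_cases h : ∃ i, 0 < u i ∧ (∀ j, u j ≤ u i) ∧ ∀ j < i, u j < u i
  · obtain ⟨i, hi⟩ := h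
    simpa using (sum_firstArgmax_of_cond hi fun _ => 1).le
  · rw [Finset.sum_eq_zero (f := fun i => firstArgmax i u) fun i _ => if_neg fun hi => h ⟨i, hi⟩]
    exact zero_le_one

/-- The sum is the positive part of the maximum of `u`; after integration it will be both the upper
bound `G` and the value of the best-response allocation. -/
theorem le_sum_firstArgmax_mul {n : ℕ} (u : Fin n → ℝ) (j : Fin n) :
    u j ≤ ∑ i, firstArgmax i u * u i := by
  by_cases hpos : 0 < u j
  · have hne : {i | ∀ j, u j ≤ u i}.Nonempty := by
      obtain ⟨i, -, hi⟩ := Finset.exists_max_image Finset.univ u ⟨j, Finset.mem_univ j⟩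
      exact ⟨i, fun k => hi k (Finset.mem_univ k)⟩
    obtain ⟨i, hi, hmin⟩ := WellFounded.has_min (wellFounded_lt (α := Fin n)) _ hne
    have hcond : 0 < u i ∧ (∀ j, u j ≤ u i) ∧ ∀ j < i, u j < u i := by
      refine ⟨hpos.trans_le (hi j), hi, fun k hk => lt_of_le_of_ne (hi k) fun heq => ?_⟩
      exact hmin k (fun l => heq ▸ hi l) hk
    rw [sum_firstArgmax_of_cond hcond]
    exact hi j
  · refine (not_lt.1 hpos).trans (Finset.sum_nonneg fun i _ => ?_)
    unfold firstArgmax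
    split_ifs with h
    · simpa using h.1.le
    · simp

theorem sum_firstArgmax_mul_nonneg {n : ℕ} (u : Fin n → ℝ) :
    0 ≤ ∑ i, firstArgmax i u * u i := by
  refine Finset.sum_nonneg fun i _ => ?_
  unfold firstArgmax
  split_ifs with h
  · simpa using h.1.le
  · simp

/-! ### Construction of the mechanism by separation in L² -/

section Existence

variable {X : Type*} [MeasurableSpace X] {μ : Measure X} [IsProbabilityMeasure μ] {n : ℕ}

/-- The embedding of the square-integrable functions of one coordinate into the square-integrable
functions of all coordinates. -/
noncomputable def evalL2 (μ : Measure X) [IsProbabilityMeasure μ] {n : ℕ} (i : Fin n) :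
    Lp ℝ 2 μ →L[ℝ] Lp ℝ 2 (Measure.pi fun _ : Fin n => μ) :=
  (Lp.compMeasurePreservingₗᵢ ℝ (Function.eval i)
    (measurePreserving_eval (fun _ : Fin n => μ) i)).toContinuousLinearMap

theorem coeFn_evalL2 (i : Fin n) (x : Lp ℝ 2 μ) :
    evalL2 μ i x =ᵐ[Measure.pi fun _ => μ] fun s => x (s i) :=
  Lp.coeFn_compMeasurePreserving x (measurePreserving_eval (fun _ : Fin n => μ) i)

/-- The adjoint of `evalL2 μ i` is conditional expectation given coordinate i, that is, the interim
map of bidder i. -/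
theorem inner_adjoint_evalL2 (i : Fin n) (x : Lp ℝ 2 μ)
    (a : Lp ℝ 2 (Measure.pi fun _ : Fin n => μ)) :
    inner ℝ x ((evalL2 μ i).adjoint a) = ∫ s, a s * x (s i) ∂(Measure.pi fun _ => μ) := by
  rw [ContinuousLinearMap.adjoint_inner_right, L2.inner_def]
  refine integral_congr_ae ?_
  filter_upwards [coeFn_evalL2 i x] with s hs
  simp [hs]

theorem coeFn_finsetSum {α ι : Type*} [MeasurableSpace α] {ν : Measure α} {p : ENNReal}
    (t : Finset ι) (a : ι → Lp ℝ p ν) :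
    ⇑(∑ i ∈ t, a i) =ᵐ[ν] fun s => ∑ i ∈ t, a i s := by
  classical
  induction t using Finset.induction_on with
  | empty =>
    simp only [Finset.sum_empty]
    exact Lp.coeFn_zero ℝ p ν
  | insert i t hi ih =>
    simp only [Finset.sum_insert hi]
    filter_upwards [Lp.coeFn_add (a i) (∑ i ∈ t, a i), ih] with s h1 h2
    rw [h1, Pi.add_apply, h2]

theorem Lp_smul_le_smul_of_nonneg {α : Type*} [MeasurableSpace α] {ν : Measure α} {p : ENNReal}
    {g k : Lp ℝ p ν} (hgk : g ≤ k) {c : ℝ} (hc : 0 ≤ c) : c • g ≤ c • k := by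
  rw [← Lp.coeFn_le] at hgk ⊢
  filter_upwards [hgk, Lp.coeFn_smul c g, Lp.coeFn_smul c k] with s h1 h2 h3
  rw [h2, h3]
  exact mul_le_mul_of_nonneg_left h1 hc

/-- The square-integrable allocation rules that satisfy the feasibility constraints. -/
def feasibleL2 (μ : Measure X) [IsProbabilityMeasure μ] (n : ℕ) :
    Set (PiLp 2 fun _ : Fin n => Lp ℝ 2 (Measure.pi fun _ : Fin n => μ)) :=
  {a | (∀ i, 0 ≤ a i) ∧
    (∑ i, a i : Lp ℝ 2 (Measure.pi fun _ : Fin n => μ)) ≤ Lp.const 2 _ (1 : ℝ)}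

theorem convex_feasibleL2 : Convex ℝ (feasibleL2 μ n) := by
  rintro a ⟨ha0, ha1⟩ c ⟨hc0, hc1⟩ u v hu hv huv
  refine ⟨fun i => ?_, ?_⟩
  · have h := add_le_add (Lp_smul_le_smul_of_nonneg (ha0 i) hu)
      (Lp_smul_le_smul_of_nonneg (hc0 i) hv)
    rwa [smul_zero, smul_zero, add_zero] at h
  · calc ∑ i, (u • a + v • c) i = u • ∑ i, a i + v • ∑ i, c i := by
          simp [Finset.sum_add_distrib, Finset.smul_sum]
      _ ≤ u • Lp.const 2 _ 1 + v • Lp.const 2 _ 1 :=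
          add_le_add (Lp_smul_le_smul_of_nonneg ha1 hu) (Lp_smul_le_smul_of_nonneg hc1 hv)
      _ = Lp.const 2 _ 1 := by rw [← add_smul, huv, one_smul]

theorem isClosed_feasibleL2 : IsClosed (feasibleL2 μ n) := by
  have hcont (i : Fin n) : Continuous fun a : PiLp 2 (fun _ : Fin n =>
      Lp ℝ 2 (Measure.pi fun _ : Fin n => μ)) => a.ofLp i := PiLp.continuous_apply 2 _ i
  refine IsClosed.inter (s₁ := {a : PiLp 2 (fun _ : Fin n =>
    Lp ℝ 2 (Measure.pi fun _ : Fin n => μ)) | ∀ i, 0 ≤ a i}) ?_ ?_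
  · simp only [Set.ofPred_forall]
    exact isClosed_iInter fun i => isClosed_le continuous_const (hcont i)
  · have hsum := continuous_finsetSum Finset.univ fun i _ => hcont i
    have hle := isClosed_le hsum (continuous_const
      (y := Lp.const 2 (Measure.pi fun _ : Fin n => μ) (1 : ℝ)))
    exact hle

theorem norm_le_of_mem_feasibleL2 {a : PiLp 2 fun _ : Fin n =>
      Lp ℝ 2 (Measure.pi fun _ : Fin n => μ)} (ha : a ∈ feasibleL2 μ n) :
    ‖a‖ ≤ √(∑ _i : Fin n, ‖Lp.const 2 (Measure.pi fun _ : Fin n => μ) (1 : ℝ)‖ ^ 2) := by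
  rw [PiLp.norm_eq_of_L2]
  gcongr with i
  refine norm_le_norm_of_abs_le_abs ?_
  rw [abs_of_nonneg (ha.1 i)]
  exact ((Finset.single_le_sum (fun j _ => ha.1 j) (Finset.mem_univ i)).trans ha.2).trans
    (le_abs_self _)

theorem mem_feasibleL2_toLp {a : Fin n → (Fin n → X) → ℝ}
    (ha : ∀ i, MemLp (a i) 2 (Measure.pi fun _ : Fin n => μ)) (h0 : ∀ i s, 0 ≤ a i s)
    (h1 : ∀ s, ∑ i, a i s ≤ 1) :
    WithLp.toLp 2 (fun i => (ha i).toLp (a i)) ∈ feasibleL2 μ n := by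
  refine ⟨fun i => ?_, ?_⟩
  · rw [← Lp.coeFn_nonneg]
    filter_upwards [(ha i).coeFn_toLp] with s hs
    exact (h0 i s).trans_eq hs.symm
  · rw [← Lp.coeFn_le]
    filter_upwards [coeFn_finsetSum Finset.univ fun i => (ha i).toLp (a i),
      ae_all_iff.2 fun i => (ha i).coeFn_toLp,
      Lp.coeFn_const (p := 2) (μ := Measure.pi fun _ : Fin n => μ) (c := (1 : ℝ))] with s h2 h3 h4
    rw [h4]
    refine (h2.trans ?_).trans_le (h1 s)
    exact Finset.sum_congr rfl fun i _ => h3 i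

theorem exists_feasibleL2_of_borderCondition {M : ℝ} {q : X → ℝ} (h : BorderCondition n M μ q)
    (hn : 1 ≤ n) (hM : 0 < M) (hq : Measurable q) (hq0 : ∀ᵐ t ∂μ, 0 ≤ q t) :
    ∃ a ∈ feasibleL2 μ n, ∀ (i : Fin n) (x : Lp ℝ 2 μ),
      ∫ s, a i s * x (s i) ∂(Measure.pi fun _ => μ) = ∫ t, q t * x t ∂μ := by
  have hqL : MemLp q 2 μ := by
    refine MemLp.of_bound hq.aestronglyMeasurable 1 ?_
    filter_upwards [hq0, h.ae_le_one hn hM hq] with t h0 h1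
    rwa [Real.norm_of_nonneg h0]
  have hinner : ∀ x : Lp ℝ 2 μ, inner ℝ x (hqL.toLp q) = ∫ t, q t * x t ∂μ := by
    intro x
    rw [L2.inner_def]
    refine integral_congr_ae ?_
    filter_upwards [hqL.coeFn_toLp] with t ht
    simp [ht]
  let T : (PiLp 2 fun _ : Fin n => Lp ℝ 2 (Measure.pi fun _ : Fin n => μ)) →L[ℝ]
      (Fin n → Lp ℝ 2 μ) :=
    ContinuousLinearMap.pi fun i => (evalL2 μ i).adjoint ∘L PiLp.proj 2 _ i
  have hsep : ∀ φ : (Fin n → Lp ℝ 2 μ) →L[ℝ] ℝ, ∃ a ∈ feasibleL2 μ n,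
      φ (fun _ => hqL.toLp q) ≤ φ (T a) := by
    intro φ
    -- Riesz representatives of the components of `φ`: the functional is a tuple of
    -- square-integrable weights, of any sign.
    let x : Fin n → Lp ℝ 2 μ := fun i =>
      (InnerProductSpace.toDual ℝ _).symm (φ ∘L ContinuousLinearMap.single ℝ (fun _ => Lp ℝ 2 μ) i)
    have hφ : ∀ z : Fin n → Lp ℝ 2 μ, φ z = ∑ i, inner ℝ (x i) (z i) := by
      intro z
      conv_lhs => rw [← Finset.univ_sum_single z, map_sum]
      simp [x, InnerProductSpace.toDual_symm_apply]
    have hxm : ∀ i, Measurable (x i) := fun i => (Lp.stronglyMeasurable (x i)).measurable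
    have hxi : ∀ i, Integrable (x i) μ := fun i =>
      (Lp.memLp (x i)).integrable one_le_two
    have hcm : Measurable fun s : Fin n → X => fun j => x j (s j) :=
      measurable_pi_lambda _ fun j => (hxm j).comp (measurable_pi_apply j)
    have hwm : ∀ i, Measurable fun s : Fin n → X => firstArgmax i fun j => x j (s j) := fun i =>
      (measurable_firstArgmax i).comp hcm
    have hw1 : ∀ i (u : Fin n → ℝ), ‖firstArgmax i u‖ ≤ 1 := fun i u => by
      rw [Real.norm_of_nonneg (firstArgmax_nonneg i u)]
      exact (Finset.single_le_sum (fun j _ => firstArgmax_nonneg j u) (Finset.mem_univ i)).trans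
        (sum_firstArgmax_le_one u)
    have hwL : ∀ i, MemLp (fun s : Fin n → X => firstArgmax i fun j => x j (s j)) 2
        (Measure.pi fun _ : Fin n => μ) := fun i =>
      MemLp.of_bound (hwm i).aestronglyMeasurable 1 (.of_forall fun s => hw1 i _)
    have hwi : ∀ i, Integrable (fun s : Fin n → X => (firstArgmax i fun j => x j (s j)) * x i (s i))
        (Measure.pi fun _ : Fin n => μ) := fun i =>
      Integrable.bdd_mul (c := 1) (((measurePreserving_eval (fun _ : Fin n => μ) i).integrable_comp
        (hxi i).aestronglyMeasurable).2 (hxi i)) (hwm i).aestronglyMeasurable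
        (.of_forall fun s => hw1 i _)
    refine ⟨_, mem_feasibleL2_toLp hwL (fun i s => firstArgmax_nonneg i _)
      (fun s => sum_firstArgmax_le_one _), ?_⟩
    rw [hφ, hφ]
    simp only [hinner]
    refine (h.sum_le_of_integrable hn hM hq hq0 hxm hxi (integrable_finsetSum Finset.univ
      fun i _ => hwi i) (fun s => sum_firstArgmax_mul_nonneg _)
      (fun s i => le_sum_firstArgmax_mul (fun j => x j (s j)) i)).trans_eq ?_
    rw [integral_finsetSum _ fun i _ => hwi i]
    refine Finset.sum_congr rfl fun i _ => ?_
    refine Eq.trans ?_ (inner_adjoint_evalL2 i (x i) ((hwL i).toLp _)).symm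
    refine integral_congr_ae ?_
    filter_upwards [(hwL i).coeFn_toLp] with s hs
    rw [hs]
  obtain ⟨a, ha, hTa⟩ := exists_map_eq_of_forall_functional_le T convex_feasibleL2
    isClosed_feasibleL2 (fun a ha => norm_le_of_mem_feasibleL2 ha) _ hsep
  refine ⟨a, ha, fun i x => ?_⟩
  rw [← inner_adjoint_evalL2, ← hinner]
  exact congrArg (inner ℝ x) (congrFun hTa i)

/-- Border's condition is sufficient for implementability. -/
theorem BorderCondition.exists_allocation {M : ℝ} {q : X → ℝ} (h : BorderCondition n M μ q)
    (hn : 1 ≤ n) (hM : 0 < M) (hq : Measurable q) (hq0 : ∀ᵐ t ∂μ, 0 ≤ q t) :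
    ∃ a : Fin n → (Fin n → X) → ℝ, (∀ i, Measurable (a i)) ∧ (∀ s i, 0 ≤ a i s) ∧
      (∀ s, ∑ i, a i s ≤ 1) ∧
      ∀ i, ∀ᵐ t ∂μ, ∫ s, a i (Function.update s i t) ∂(Measure.pi fun _ => μ) = q t := by
  obtain ⟨a, ⟨ha0, ha1⟩, ha⟩ := exists_feasibleL2_of_borderCondition h hn hM hq hq0
  have ham : ∀ i, Measurable (a i) := fun i => (Lp.stronglyMeasurable (a i)).measurable
  -- The L² constraints hold only almost everywhere; allocating nothing off `good` makes them hold
  -- at every profile.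
  set good : Set (Fin n → X) := {s | (∀ i, 0 ≤ a i s) ∧ ∑ i, a i s ≤ 1} with hgood
  have hgm : MeasurableSet good := by
    refine MeasurableSet.inter (s₁ := {s | ∀ i, 0 ≤ a i s}) ?_ ?_
    · simp only [Set.ofPred_forall]
      exact MeasurableSet.iInter fun i => measurableSet_le measurable_const (ham i)
    · exact measurableSet_le (Finset.measurable_sum _ fun i _ => ham i) measurable_const
  have hgae : ∀ᵐ s ∂(Measure.pi fun _ : Fin n => μ), s ∈ good := by
    rw [← Lp.coeFn_le] at ha1
    filter_upwards [ae_all_iff.2 fun i => (Lp.coeFn_nonneg (a i)).2 (ha0 i), ha1,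
      coeFn_finsetSum Finset.univ fun i => a i,
      Lp.coeFn_const (p := 2) (μ := Measure.pi fun _ : Fin n => μ) (c := (1 : ℝ))] with s h1 h2 h3 h4
    rw [h3, h4] at h2
    exact ⟨h1, h2⟩
  have hnn : ∀ s i, 0 ≤ good.indicator (a i) s := fun s i =>
    Set.indicator_nonneg (fun s hs => hs.1 i) s
  have hsum : ∀ s, ∑ i, good.indicator (a i) s ≤ 1 := fun s => by
    by_cases hs : s ∈ good
    · simpa [hs] using hs.2
    · simp [hs]
  have hm : ∀ i, Measurable (good.indicator (a i)) := fun i => (ham i).indicator hgm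
  refine ⟨fun i => good.indicator (a i), hm, hnn, hsum, fun i => ?_⟩
  have hle : ∀ s, ‖good.indicator (a i) s‖ ≤ 1 := fun s => by
    rw [Real.norm_of_nonneg (hnn s i)]
    exact (Finset.single_le_sum (fun j _ => hnn s j) (Finset.mem_univ i)).trans (hsum s)
  -- Equality against every L² weight is used for indicators, which determine the interim allocation
  -- almost everywhere.
  refine Integrable.ae_eq_of_forall_setIntegral_eq _ _ ?_ (h.integrable hM) fun E hE _ => ?_
  · refine Integrable.of_bound (C := 1) ?_ (.of_forall fun t => ?_)
    · have hupd : Measurable fun p : X × (Fin n → X) => Function.update p.2 i p.1 :=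
        (measurePreserving_update μ i).measurable
      exact (StronglyMeasurable.integral_prod_right
        (f := fun t s => good.indicator (a i) (Function.update s i t))
        ((hm i).comp hupd).stronglyMeasurable).aestronglyMeasurable
    · exact (norm_integral_le_of_norm_le_const (.of_forall fun s => hle _)).trans (by simp)
  · have hEL : MemLp (E.indicator fun _ => (1 : ℝ)) 2 μ :=
      (memLp_const 1).indicator hE
    have hmul : ∀ (g : X → ℝ) t, E.indicator g t = g t * E.indicator (fun _ => 1) t := by
      intro g t
      by_cases ht : t ∈ E <;> simp [ht]
    rw [← integral_indicator hE, ← integral_indicator hE]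
    simp only [hmul (fun t => ∫ s, _ ∂_), hmul q]
    rw [← integral_pi_mul_eval μ i (a := good.indicator (a i)) (y := E.indicator fun _ => 1)]
    · have h1 := ha i (hEL.toLp _)
      have h2 : ∫ t, q t * hEL.toLp _ t ∂μ = ∫ t, q t * E.indicator (fun _ => 1) t ∂μ := by
        refine integral_congr_ae ?_
        filter_upwards [hEL.coeFn_toLp] with t ht
        rw [ht]
      rw [← h2, ← h1]
      refine integral_congr_ae ?_
      filter_upwards [hgae, ae_pi_eval μ hEL.coeFn_toLp i] with s hs ht
      rw [ht, Set.indicator_of_mem hs]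
    · refine Integrable.of_bound (C := 1) ((hm i).mul ((measurable_const.indicator hE).comp
        (measurable_pi_apply i))).aestronglyMeasurable (.of_forall fun s => ?_)
      rw [norm_mul]
      refine mul_le_one₀ (hle s) (norm_nonneg _) ?_
      by_cases ht : s i ∈ E <;> simp [ht]

end Existence

/-! ### The law of one bidder's type -/

section TypeLaw

variable {b : ℝ} {f : ℝ → ℝ}

theorem typeLaw_ae_mem_Icc : ∀ᵐ t ∂(typeLaw b f), t ∈ Set.Icc 0 b :=
  (withDensity_absolutelyContinuous _ _).ae_le (ae_restrict_mem measurableSet_Icc)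

theorem isProbabilityMeasure_typeLaw (hf_nonneg : ∀ t ∈ Set.Icc 0 b, 0 ≤ f t)
    (hf_one : ∫ t in Set.Icc 0 b, f t = 1) : IsProbabilityMeasure (typeLaw b f) := by
  -- The integral of a non-integrable function is 0 by convention, so total mass 1 already forces
  -- integrability.
  have hint : IntegrableOn f (Set.Icc 0 b) := by
    by_contra h
    rw [integral_undef h] at hf_one
    exact zero_ne_one hf_one
  refine ⟨?_⟩
  rw [typeLaw, withDensity_apply _ MeasurableSet.univ, Measure.restrict_univ,
    ← ofReal_integral_eq_lintegral_ofReal hint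
    ((ae_restrict_iff' measurableSet_Icc).2 (.of_forall hf_nonneg)), hf_one, ENNReal.ofReal_one]

theorem setIntegral_mul_density (hf_meas : Measurable f) (hf_nonneg : ∀ t ∈ Set.Icc 0 b, 0 ≤ f t)
    (g : ℝ → ℝ) {C : Set ℝ} (hC : MeasurableSet C) (hCb : C ⊆ Set.Icc 0 b) :
    ∫ t in C, g t * f t = ∫ t in C, g t ∂(typeLaw b f) := by
  rw [typeLaw, setIntegral_withDensity_eq_setIntegral_toReal_smul hf_meas.ennreal_ofReal
    (.of_forall fun _ => ENNReal.ofReal_lt_top) g hC, Measure.restrict_restrict hC,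
    Set.inter_eq_left.2 hCb]
  refine setIntegral_congr_fun hC fun t ht => ?_
  simp only [ENNReal.toReal_ofReal (hf_nonneg t (hCb ht)), smul_eq_mul]
  exact mul_comm _ _

theorem setIntegral_density (hf_meas : Measurable f) (hf_nonneg : ∀ t ∈ Set.Icc 0 b, 0 ≤ f t)
    {C : Set ℝ} (hC : MeasurableSet C) (hCb : C ⊆ Set.Icc 0 b) :
    ∫ t in C, f t = (typeLaw b f).real C := by
  simpa using setIntegral_mul_density hf_meas hf_nonneg (fun _ => 1) hC hCb

theorem setIntegral_Icc_mul_density (hf_meas : Measurable f)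
    (hf_nonneg : ∀ t ∈ Set.Icc 0 b, 0 ≤ f t) (q x : ℝ → ℝ) :
    ∫ t in Set.Icc 0 b, q t * f t * x t = ∫ t, q t * x t ∂(typeLaw b f) := by
  simp only [mul_right_comm _ (f _)]
  rw [setIntegral_mul_density hf_meas hf_nonneg _ measurableSet_Icc le_rfl,
    Measure.restrict_eq_self_of_ae_mem typeLaw_ae_mem_Icc]

theorem integrableOn_Icc_mul_density_iff (hf_meas : Measurable f)
    (hf_nonneg : ∀ t ∈ Set.Icc 0 b, 0 ≤ f t) (q x : ℝ → ℝ) :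
    IntegrableOn (fun t => q t * f t * x t) (Set.Icc 0 b) ↔
      Integrable (fun t => q t * x t) (typeLaw b f) := by
  rw [typeLaw, integrable_withDensity_iff_integrable_smul' hf_meas.ennreal_ofReal
    (.of_forall fun _ => ENNReal.ofReal_lt_top)]
  refine integrableOn_congr_fun (fun t ht => ?_) measurableSet_Icc
  simp only [ENNReal.toReal_ofReal (hf_nonneg t ht), smul_eq_mul]
  ring

theorem borderBound_eq (hf_meas : Measurable f) (hf_nonneg : ∀ t ∈ Set.Icc 0 b, 0 ≤ f t)
    (n : ℕ) (vbar : ℝ) {x : ℝ → ℝ} (hx : Measurable x) :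
    borderBound n b vbar f x =
      ∫ v in (0 : ℝ)..vbar, (1 - (1 - (typeLaw b f).real {t | v ≤ x t}) ^ n) / n := by
  unfold borderBound
  congr 1 with v
  have hset : {t ∈ Set.Icc 0 b | v ≤ x t} =ᵐ[typeLaw b f] {t | v ≤ x t} := by
    filter_upwards [typeLaw_ae_mem_Icc] with t ht
    exact propext ⟨fun h => h.2, fun h => ⟨ht, h⟩⟩
  rw [setIntegral_density (C := {t | t ∈ Set.Icc 0 b ∧ v ≤ x t}) hf_meas hf_nonneg
    (measurableSet_Icc.inter (measurableSet_le measurable_const hx)) fun t ht => ht.1,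
    measureReal_congr hset]

end TypeLaw

/-! ### Implementable interim allocations -/

section Implementable

variable {n : ℕ} {b : ℝ} {f : ℝ → ℝ} [IsProbabilityMeasure (typeLaw b f)]

theorem FeasibleAllocation.ae_feasible (M : FeasibleAllocation n b) :
    ∀ᵐ s ∂(Measure.pi fun _ : Fin n => typeLaw b f),
      (∀ i, 0 ≤ M.alloc i s) ∧ ∑ i, M.alloc i s ≤ 1 := by
  filter_upwards [ae_all_iff.2 fun i : Fin n =>
    ae_pi_eval (typeLaw b f) typeLaw_ae_mem_Icc i] with s hs
  exact ⟨M.alloc_nonneg s hs, M.sum_alloc_le_one s hs⟩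

theorem FeasibleAllocation.ae_mem_Icc (M : FeasibleAllocation n b) (i : Fin n) :
    ∀ᵐ s ∂(Measure.pi fun _ : Fin n => typeLaw b f), M.alloc i s ∈ Set.Icc 0 1 := by
  filter_upwards [M.ae_feasible (f := f)] with s hs
  exact ⟨hs.1 i, (Finset.single_le_sum (fun j _ => hs.1 j) (Finset.mem_univ i)).trans hs.2⟩

variable {q : ℝ → ℝ} {vbar : ℝ} {x : ℝ → ℝ}

theorem FeasibleAllocation.integrable_alloc_mul (M : FeasibleAllocation n b) (i : Fin n)
    (hx : IsVirtualValue b vbar x) :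
    Integrable (fun s => M.alloc i s * x (s i)) (Measure.pi fun _ : Fin n => typeLaw b f) := by
  refine Integrable.of_bound (C := vbar) ((M.measurable_alloc i).mul
    (hx.1.comp (measurable_pi_apply i))).aestronglyMeasurable ?_
  filter_upwards [M.ae_mem_Icc (f := f) i,
    ae_pi_eval (typeLaw b f) typeLaw_ae_mem_Icc i] with s h1 h2
  have h3 := hx.2 _ h2
  rw [Real.norm_of_nonneg (mul_nonneg h1.1 h3.1)]
  exact (mul_le_of_le_one_left h3.1 h1.2).trans h3.2

theorem FeasibleAllocation.integral_alloc_mul (M : FeasibleAllocation n b) (i : Fin n)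
    (hM : ∀ᵐ t ∂(typeLaw b f), M.interim f i t = q t) (hx : IsVirtualValue b vbar x) :
    ∫ s, M.alloc i s * x (s i) ∂(Measure.pi fun _ : Fin n => typeLaw b f) =
      ∫ t, q t * x t ∂(typeLaw b f) := by
  rw [integral_pi_mul_eval _ i (M.integrable_alloc_mul i hx)]
  refine integral_congr_ae ?_
  filter_upwards [hM] with t ht
  rw [← ht]
  rfl

theorem Implementable.ae_mem_Icc (h : Implementable n b f q) (hn : 1 ≤ n) :
    ∀ᵐ t ∂(typeLaw b f), q t ∈ Set.Icc 0 1 := by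
  obtain ⟨M, hM⟩ := h
  have i : Fin n := ⟨0, hn⟩
  filter_upwards [hM i, ae_ae_update (typeLaw b f) (M.ae_mem_Icc i) i] with t h1 h2
  rw [← h1]
  refine ⟨integral_nonneg_of_ae (h2.mono fun s hs => hs.1), ?_⟩
  refine (integral_mono_of_nonneg (h2.mono fun s hs => hs.1) (integrable_const 1)
    (h2.mono fun s hs => hs.2)).trans (by simp)

theorem Implementable.integrable (h : Implementable n b f q) (hn : 1 ≤ n) (hq : Measurable q) :
    Integrable q (typeLaw b f) := by
  refine Integrable.of_bound (C := 1) hq.aestronglyMeasurable ?_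
  filter_upwards [h.ae_mem_Icc hn] with t ht
  rw [Real.norm_of_nonneg ht.1]
  exact ht.2

theorem Implementable.integrable_mul (h : Implementable n b f q) (hn : 1 ≤ n) (hq : Measurable q)
    (hx : IsVirtualValue b vbar x) : Integrable (fun t => q t * x t) (typeLaw b f) := by
  refine (h.integrable hn hq).mul_bdd (c := vbar) hx.1.aestronglyMeasurable ?_
  filter_upwards [typeLaw_ae_mem_Icc] with t ht
  rw [Real.norm_of_nonneg (hx.2 t ht).1]
  exact (hx.2 t ht).2

theorem ae_eval_mem_Icc (hx : IsVirtualValue b vbar x) :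
    ∀ᵐ s ∂(Measure.pi fun _ : Fin n => typeLaw b f), ∀ i, x (s i) ∈ Set.Icc 0 vbar := by
  filter_upwards [ae_all_iff.2 fun i : Fin n =>
    ae_pi_eval (typeLaw b f) typeLaw_ae_mem_Icc i] with s hs i
  exact hx.2 _ (hs i)

theorem sum_mul_le_ciSup {a u : Fin n → ℝ} (ha : ∀ i, 0 ≤ a i) (ha1 : ∑ i, a i ≤ 1)
    (hu : ∀ i, 0 ≤ u i) : ∑ i, a i * u i ≤ ⨆ i, u i := by
  have hsup : ∀ i, u i ≤ ⨆ i, u i := le_ciSup (Set.finite_range u).bddAbove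
  calc ∑ i, a i * u i ≤ ∑ i, a i * ⨆ i, u i :=
        Finset.sum_le_sum fun i _ => mul_le_mul_of_nonneg_left (hsup i) (ha i)
    _ = (∑ i, a i) * ⨆ i, u i := (Finset.sum_mul ..).symm
    _ ≤ ⨆ i, u i := mul_le_of_le_one_left (Real.iSup_nonneg hu) ha1

/-- The bound in Border's condition is the expected highest virtual value per bidder. -/
theorem integral_iSup_eq_mul_borderBound (hf_meas : Measurable f)
    (hf_nonneg : ∀ t ∈ Set.Icc 0 b, 0 ≤ f t) (hn : 1 ≤ n) (hvbar : 0 ≤ vbar)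
    (hx : IsVirtualValue b vbar x) :
    ∫ s : Fin n → ℝ, ⨆ i, x (s i) ∂(Measure.pi fun _ => typeLaw b f) =
      n * borderBound n b vbar f x := by
  have : Nonempty (Fin n) := ⟨⟨0, hn⟩⟩
  have hn' : (n : ℝ) ≠ 0 := by positivity
  rw [integral_iSup_eval (y := fun _ => x) (fun _ => hx.1) hvbar
    fun _ => typeLaw_ae_mem_Icc.mono hx.2, borderBound_eq hf_meas hf_nonneg n vbar hx.1,
    ← intervalIntegral.integral_const_mul]
  congr 1 with v
  rw [mul_div_cancel₀ _ hn']
  simp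

theorem FeasibleAllocation.integral_sum_alloc_mul (M : FeasibleAllocation n b)
    (hM : ∀ i, ∀ᵐ t ∂(typeLaw b f), M.interim f i t = q t) (hx : IsVirtualValue b vbar x) :
    ∫ s, ∑ i, M.alloc i s * x (s i) ∂(Measure.pi fun _ : Fin n => typeLaw b f) =
      n * ∫ t, q t * x t ∂(typeLaw b f) := by
  rw [integral_finsetSum _ fun i _ => M.integrable_alloc_mul i hx,
    Finset.sum_congr rfl fun i _ => M.integral_alloc_mul i (hM i) hx]
  simp

theorem FeasibleAllocation.ae_sum_alloc_mul_le (M : FeasibleAllocation n b)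
    (hx : IsVirtualValue b vbar x) : ∀ᵐ s ∂(Measure.pi fun _ : Fin n => typeLaw b f),
      ∑ i, M.alloc i s * x (s i) ≤ ⨆ i, x (s i) := by
  filter_upwards [M.ae_feasible (f := f), ae_eval_mem_Icc hx] with s h1 h2
  exact sum_mul_le_ciSup h1.1 h1.2 fun i => (h2 i).1

theorem Implementable.integral_le_borderBound (h : Implementable n b f q)
    (hf_meas : Measurable f) (hf_nonneg : ∀ t ∈ Set.Icc 0 b, 0 ≤ f t) (hn : 1 ≤ n)
    (hvbar : 0 ≤ vbar) (hx : IsVirtualValue b vbar x) :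
    ∫ t, q t * x t ∂(typeLaw b f) ≤ borderBound n b vbar f x := by
  have : Nonempty (Fin n) := ⟨⟨0, hn⟩⟩
  obtain ⟨M, hM⟩ := h
  have hn' : (0 : ℝ) < n := by exact_mod_cast hn
  refine le_of_mul_le_mul_left ?_ hn'
  rw [← M.integral_sum_alloc_mul hM hx,
    ← integral_iSup_eq_mul_borderBound hf_meas hf_nonneg hn hvbar hx]
  exact integral_mono_ae (integrable_finsetSum _ fun i _ => M.integrable_alloc_mul i hx)
    (integrable_iSup_eval (y := fun _ => x) (fun _ => hx.1)
      fun _ => typeLaw_ae_mem_Icc.mono hx.2) (M.ae_sum_alloc_mul_le hx)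

/-- Raise the value of i alone from `u i` to `w i`. If someone beats i at `u`, optimality gives `a i
= 0`. Otherwise i becomes the unique maximizer at `w`, with a positive value, and optimality gives
`c i = 1`. -/
theorem alloc_le_of_sum_mul_eq_ciSup {a c u w : Fin n → ℝ} (hc : ∀ i, 0 ≤ c i)
    (ha : ∀ i, 0 ≤ a i) (ha1 : ∑ i, a i ≤ 1) (hc1 : ∑ i, c i ≤ 1) (hu : ∀ i, 0 ≤ u i)
    (hau : ∑ i, a i * u i = ⨆ i, u i) (hcw : ∑ i, c i * w i = ⨆ i, w i) {i : Fin n}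
    (huw : ∀ j ≠ i, u j = w j) (hi : u i < w i) : a i ≤ c i := by
  have hlu : ∀ j, u j ≤ ⨆ j, u j := le_ciSup (Set.finite_range u).bddAbove
  have hlw : ∀ j, w j ≤ ⨆ j, w j := le_ciSup (Set.finite_range w).bddAbove
  have hw : ∀ j, 0 ≤ w j := fun j => by
    by_cases hj : j = i
    · subst hj; exact (hu j).trans hi.le
    · exact huw j hj ▸ hu j
  by_cases hex : ∃ j, u i < u j
  · obtain ⟨j, hj⟩ := hex
    -- All terms are nonnegative, so each vanishes: non-maximizers receive nothing.
    have h1 : ∑ k, a k * ((⨆ j, u j) - u k) ≤ 0 := by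
      simp only [mul_sub, Finset.sum_sub_distrib, ← Finset.sum_mul, hau]
      nlinarith [(hu i).trans (hlu i)]
    have h2 : a i * ((⨆ j, u j) - u i) ≤ 0 :=
      (Finset.single_le_sum (fun k _ => mul_nonneg (ha k) (sub_nonneg.2 (hlu k)))
        (Finset.mem_univ i)).trans h1
    have h3 : a i ≤ 0 := nonpos_of_mul_nonpos_left h2 (sub_pos.2 (hj.trans_le (hlu j)))
    exact h3.trans (hc i)
  · push Not at hex
    have : Nonempty (Fin n) := ⟨i⟩
    have hmax : ⨆ j, w j = w i := le_antisymm (ciSup_le fun j => by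
      by_cases hj : j = i
      · rw [hj]
      · exact huw j hj ▸ (hex j).trans hi.le) (hlw i)
    rw [hmax, ← Finset.add_sum_erase _ _ (Finset.mem_univ i)] at hcw
    rw [← Finset.add_sum_erase _ _ (Finset.mem_univ i)] at hc1
    have h1 : ∑ j ∈ Finset.univ.erase i, c j * w j ≤ (∑ j ∈ Finset.univ.erase i, c j) * u i := by
      rw [Finset.sum_mul]
      refine Finset.sum_le_sum fun j hj => mul_le_mul_of_nonneg_left ?_ (hc j)
      exact huw j (Finset.ne_of_mem_erase hj) ▸ hex j
    have h2 : a i ≤ 1 := (Finset.single_le_sum (fun k _ => ha k) (Finset.mem_univ i)).trans ha1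
    have h3 : 1 ≤ c i := by
      have h4 := hu i
      have h5 : 0 ≤ ∑ j ∈ Finset.univ.erase i, c j := Finset.sum_nonneg fun j _ => hc j
      by_contra! hlt
      have h6 : w i ≤ c i * w i + (1 - c i) * u i := by nlinarith
      nlinarith
    exact h2.trans h3

/-- If equality holds in Border's condition for `x`, then almost surely the interim allocation is
increasing in the virtual value `x`. -/
theorem Implementable.exists_monotone_set (h : Implementable n b f q)
    (hf_meas : Measurable f) (hf_nonneg : ∀ t ∈ Set.Icc 0 b, 0 ≤ f t) (hn : 1 ≤ n)
    (hvbar : 0 ≤ vbar) (hx : IsVirtualValue b vbar x)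
    (heq : ∫ t, q t * x t ∂(typeLaw b f) = borderBound n b vbar f x) :
    ∃ p : ℝ → Prop, (∀ᵐ t ∂(typeLaw b f), p t) ∧
      ∀ c d, p c → p d → x d < x c → q d ≤ q c := by
  have : Nonempty (Fin n) := ⟨⟨0, hn⟩⟩
  obtain ⟨M, hM⟩ := h
  -- One bidder suffices, as all share the interim rule `q`.
  let i : Fin n := ⟨0, hn⟩
  have hint := integrable_finsetSum (Finset.univ : Finset (Fin n)) fun i _ =>
    M.integrable_alloc_mul (f := f) i hx
  have hsup := integrable_iSup_eval (ι := Fin n) (μ := typeLaw b f) (y := fun _ => x)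
    (fun _ => hx.1) fun _ => typeLaw_ae_mem_Icc.mono hx.2
  have hopt : ∀ᵐ s ∂(Measure.pi fun _ : Fin n => typeLaw b f),
      ∑ i, M.alloc i s * x (s i) = ⨆ i, x (s i) := by
    -- An almost sure inequality between integrable functions with equal integrals is an equality
    -- almost surely.
    refine (integral_eq_iff_of_ae_le hint hsup (M.ae_sum_alloc_mul_le hx)).1 ?_
    rw [M.integral_sum_alloc_mul hM hx,
      integral_iSup_eq_mul_borderBound hf_meas hf_nonneg hn hvbar hx, heq]
  have hall : ∀ᵐ s ∂(Measure.pi fun _ : Fin n => typeLaw b f),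
      ((∀ i, 0 ≤ M.alloc i s) ∧ ∑ i, M.alloc i s ≤ 1) ∧ (∀ i, x (s i) ∈ Set.Icc 0 vbar) ∧
        ∑ i, M.alloc i s * x (s i) = ⨆ i, x (s i) := by
    filter_upwards [M.ae_feasible (f := f), ae_eval_mem_Icc hx, hopt] with s h1 h2 h3
      using ⟨h1, h2, h3⟩
  -- Good types: the interim value is `q t`, and feasibility and optimality hold for almost all
  -- opposing types. Two good types can be compared against the same opponents `s`.
  refine ⟨fun t => M.interim f i t = q t ∧ ∀ᵐ s ∂(Measure.pi fun _ : Fin n => typeLaw b f),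
      ((∀ j, 0 ≤ M.alloc j (Function.update s i t)) ∧
        ∑ j, M.alloc j (Function.update s i t) ≤ 1) ∧
        (∀ j, x (Function.update s i t j) ∈ Set.Icc 0 vbar) ∧
        ∑ j, M.alloc j (Function.update s i t) * x (Function.update s i t j) =
          ⨆ j, x (Function.update s i t j), (hM i).and (ae_ae_update _ hall i), ?_⟩
  rintro c d ⟨hc, hc'⟩ ⟨hd, hd'⟩ hdc
  rw [← hc, ← hd]
  refine integral_mono_of_nonneg (hd'.mono fun s hs => hs.1.1 i) ?_ ?_
  · have hmeas : Measurable fun s : Fin n → ℝ => Function.update s i c :=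
      measurable_update_left
    refine Integrable.of_bound (C := 1)
      ((M.measurable_alloc i).comp hmeas).aestronglyMeasurable (hc'.mono fun s hs => ?_)
    rw [Real.norm_of_nonneg (hs.1.1 i)]
    exact (Finset.single_le_sum (fun j _ => hs.1.1 j) (Finset.mem_univ i)).trans hs.1.2
  · filter_upwards [hc', hd'] with s hs hs'
    refine alloc_le_of_sum_mul_eq_ciSup hs.1.1 hs'.1.1 hs'.1.2 hs.1.2 (fun j => (hs'.2.1 j).1)
      hs'.2.2 hs.2.2 (fun j hj => ?_) ?_
    · simp [hj]
    · simpa using hdc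

end Implementable

/-- Integrate `q d ≤ q c` over c in `C`, then over d in `D`; this is the comparison of averages with
denominators cleared. -/
theorem setIntegral_mul_le_of_ae_le {X : Type*} [MeasurableSpace X] {μ : Measure X}
    [IsFiniteMeasure μ] {q : X → ℝ} (hq : Integrable q μ) {C D : Set X} (hC : MeasurableSet C)
    (hD : MeasurableSet D) (h : ∀ᵐ d ∂μ, ∀ᵐ c ∂μ, d ∈ D → c ∈ C → q d ≤ q c) :
    (∫ t in D, q t ∂μ) * μ.real C ≤ (∫ t in C, q t ∂μ) * μ.real D := by
  have h1 : ∀ᵐ d ∂μ, d ∈ D → q d * μ.real C ≤ ∫ t in C, q t ∂μ := by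
    filter_upwards [h] with d hd hdD
    have h2 : ∫ _t in C, q d ∂μ ≤ ∫ t in C, q t ∂μ := by
      refine setIntegral_mono_on_ae (integrable_const _) hq.integrableOn hC ?_
      filter_upwards [hd] with c hc using hc hdD
    simpa [mul_comm] using h2
  have h3 : ∫ t in D, q t * μ.real C ∂μ ≤ ∫ _t in D, (∫ t in C, q t ∂μ) ∂μ :=
    setIntegral_mono_on_ae (hq.integrableOn.mul_const _) (integrable_const _) hD h1
  rw [integral_mul_const] at h3
  simpa [mul_comm] using h3

theorem mainTheorem1 (n : ℕ) (hn : 1 ≤ n) (b : ℝ) (hb : 0 < b)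
    (f : ℝ → ℝ) (hf_meas : Measurable f) (hf_nonneg : ∀ t ∈ Set.Icc 0 b, 0 ≤ f t)
    (hf_one : ∫ t in Set.Icc 0 b, f t = 1)
    (q : ℝ → ℝ) (hq_meas : Measurable q) (hq_nonneg : ∀ t ∈ Set.Icc 0 b, 0 ≤ q t)
    (vbar : ℝ) (hvbar : 0 < vbar) :
    (Implementable n b f q ↔
      ∀ x : ℝ → ℝ, IsVirtualValue b vbar x →
        IntegrableOn (fun t => q t * f t * x t) (Set.Icc 0 b) ∧
        ∫ t in Set.Icc 0 b, q t * f t * x t ≤ borderBound n b vbar f x) ∧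
    (Implementable n b f q →
      ∀ x : ℝ → ℝ, IsVirtualValue b vbar x →
        ∫ t in Set.Icc 0 b, q t * f t * x t = borderBound n b vbar f x →
        ∀ C D : Set ℝ, MeasurableSet C → MeasurableSet D →
          C ⊆ Set.Icc 0 b → D ⊆ Set.Icc 0 b →
          0 < ∫ t in C, f t → 0 < ∫ t in D, f t →
          (∀ c ∈ C, ∀ d ∈ D, x d < x c) →
          (∫ t in D, q t * f t) / (∫ t in D, f t) ≤ (∫ t in C, q t * f t) / (∫ t in C, f t)) := by
  have := isProbabilityMeasure_typeLaw hf_nonneg hf_one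
  refine ⟨⟨fun h x hx => ⟨?_, ?_⟩, fun h => ?_⟩,
    fun h x hx heq C D hC hD hCb hDb hCpos hDpos hCD => ?_⟩
  · rw [integrableOn_Icc_mul_density_iff hf_meas hf_nonneg]
    exact h.integrable_mul hn hq_meas hx
  · rw [setIntegral_Icc_mul_density hf_meas hf_nonneg]
    exact h.integral_le_borderBound hf_meas hf_nonneg hn hvbar.le hx
  · have hB : BorderCondition n vbar (typeLaw b f) q := by
      intro y hy hyM
      have hxy := h y ⟨hy, fun t _ => hyM t⟩
      rwa [integrableOn_Icc_mul_density_iff hf_meas hf_nonneg,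
        setIntegral_Icc_mul_density hf_meas hf_nonneg,
        borderBound_eq hf_meas hf_nonneg n vbar hy] at hxy
    obtain ⟨a, ham, ha0, ha1, ha⟩ := hB.exists_allocation hn hvbar hq_meas
      (typeLaw_ae_mem_Icc.mono hq_nonneg)
    exact ⟨⟨a, ham, fun t _ => ha0 t, fun t _ => ha1 t⟩, ha⟩
  · rw [setIntegral_Icc_mul_density hf_meas hf_nonneg] at heq
    obtain ⟨p, hp, hmono⟩ := h.exists_monotone_set hf_meas hf_nonneg hn hvbar.le hx heq
    rw [setIntegral_density hf_meas hf_nonneg hC hCb] at hCpos ⊢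
    rw [setIntegral_density hf_meas hf_nonneg hD hDb] at hDpos ⊢
    rw [setIntegral_mul_density hf_meas hf_nonneg q hC hCb,
      setIntegral_mul_density hf_meas hf_nonneg q hD hDb, div_le_div_iff₀ hDpos hCpos]
    refine setIntegral_mul_le_of_ae_le (h.integrable hn hq_meas) hC hD ?_
    filter_upwards [hp] with d hd
    filter_upwards [hp] with c hc hdD hcC
    exact hmono c d hc hd (hCD c hcC d hdD)
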